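/- Theorem 3.5. Let $\mathbb F$ be an algebraically closed field of characteristic $\neq 2,3$, let $L=L_0\oplus L_1$ be a finite-dimensional nilpotent Lie superalgebra over $\mathbb F$ and $N$ a graded ideal of $L$ (so that $(N,L)$ is a pair of finite-dimensional nilpotent Lie superalgebras), with $\dim N=(m|n)$, i.e. $\dim(N\cap L_0)=m$ and $\dim(N\cap L_1)=n$. Put $[N,L]=\langle [x,y] \mid x\in N,\ y\in L\rangle$ and $Z(N,L)=\{x\in N \mid [x,y]=0 \text{ for all } y\in L\}$. For a free presentation $0\to R\to F\to L\to 0$, with $F$ a free Lie superalgebra and $S$ the preimage of $N$ in $F$, let $$\mathcal M(N,L)=\frac{R\cap[S,F]}{[R,F]}$$ be the Schur multiplier of the pair, which up to isomorphism does not depend on the presentation. In the following formula $\dim N$ $(=m+n)$, $\dim(L/N)$ and $\dim\mathcal M(N,L)$ are total dimensions. If $$\dim\mathcal M(N,L)=\tfrac12\big((m+n)^2+(n-m)\big)+\dim N\cdot\dim(L/N)-1,$$ then $L$ is non-abelian, and either $[N,L]=0$, or $\dim[N,L]=1$ and $[N,L]=Z(N,L)$. -/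

import Mathlib

/-- The sign `(-1)^(a b)` for degrees `a, b ∈ ℤ/2`. -/
def superSign (𝕜 : Type*) [Field 𝕜] (a b : ZMod 2) : 𝕜 := (-1) ^ (a.val * b.val)

/-- A Lie superalgebra over `𝕜`: a superspace `L = L₀ ⊕ L₁` (`part a` is `L_a`) with a bilinear
graded bracket `br` satisfying graded antisymmetry and the graded Jacobi identity. -/
class LieSuperalgebra (𝕜 : Type*) (L : Type*) [Field 𝕜] [AddCommGroup L] [Module 𝕜 L] where
  part : ZMod 2 → Submodule 𝕜 L
  isCompl_part : IsCompl (part 0) (part 1)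
  br (𝕜) : L →ₗ[𝕜] L →ₗ[𝕜] L
  br_mem : ∀ {a b : ZMod 2} {x y : L}, x ∈ part a → y ∈ part b → br x y ∈ part (a + b)
  br_antisymm : ∀ {a b : ZMod 2} {x y : L}, x ∈ part a → y ∈ part b →
    br x y = -(superSign 𝕜 a b • br y x)
  br_jacobi : ∀ {a b c : ZMod 2} {x y z : L}, x ∈ part a → y ∈ part b → z ∈ part c →
    superSign 𝕜 a c • br x (br y z) + superSign 𝕜 b a • br y (br z x)
      + superSign 𝕜 c b • br z (br x y) = 0

namespace LieSuperalgebra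

section Basic

variable (𝕜 : Type*) {L : Type*} [Field 𝕜] [AddCommGroup L] [Module 𝕜 L] [LieSuperalgebra 𝕜 L]

/-- `[A, B]`: the span of all brackets `[x, y]` with `x ∈ A` and `y ∈ B`. -/
def commutator (A B : Submodule 𝕜 L) : Submodule 𝕜 L :=
  Submodule.span 𝕜 {z | ∃ x ∈ A, ∃ y ∈ B, br 𝕜 x y = z}

/-- `N` is a graded ideal of `L`, i.e. `(N, L)` is a pair of Lie superalgebras:
`N = (N ∩ L₀) + (N ∩ L₁)` and `[N, L] ⊆ N`. -/
structure IsGradedIdeal (N : Submodule 𝕜 L) : Prop where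
  graded : N = (N ⊓ part 0) ⊔ (N ⊓ part 1)
  br_mem : ∀ x ∈ N, ∀ y : L, br 𝕜 x y ∈ N

/-- `Z(N, L) = {n ∈ N | [n, x] = 0 for all x ∈ L}`. -/
def pairCenter (N : Submodule 𝕜 L) : Submodule 𝕜 L where
  carrier := {n | n ∈ N ∧ ∀ x : L, br 𝕜 n x = 0}
  zero_mem' := ⟨N.zero_mem, fun x => by simp⟩
  add_mem' := fun ha hb => ⟨N.add_mem ha.1 hb.1, fun x => by simp [ha.2 x, hb.2 x]⟩
  smul_mem' := fun c _ ha => ⟨N.smul_mem c ha.1, fun x => by simp [ha.2 x]⟩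

variable (L)

def IsAbelian : Prop := ∀ x y : L, br 𝕜 x y = 0

/-- The lower central series, `lowerCentral i` being `L^{i+1}`: `L^1 = L`, `L^{i+1} = [L^i, L]`. -/
def lowerCentral : ℕ → Submodule 𝕜 L
  | 0 => ⊤
  | i + 1 => commutator 𝕜 (lowerCentral i) ⊤

def IsNilpotent : Prop := ∃ c : ℕ, lowerCentral 𝕜 L c = ⊥

/-- Homomorphisms of Lie superalgebras: even linear maps that preserve the bracket. -/
structure Hom (K : Type*) [AddCommGroup K] [Module 𝕜 K] [LieSuperalgebra 𝕜 K]
    extends L →ₗ[𝕜] K where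
  map_part : ∀ (a : ZMod 2), ∀ x ∈ (part a : Submodule 𝕜 L), toFun x ∈ (part a : Submodule 𝕜 K)
  map_br : ∀ x y : L, toFun (br 𝕜 x y) = br 𝕜 (toFun x) (toFun y)

end Basic

end LieSuperalgebra

/-! ### Free Lie superalgebras

The free Lie superalgebra on a set `X` of generators with parities `p : X → ℤ/2` is the free
non-associative algebra on `X`, modulo the ideal generated by graded antisymmetry and the graded
Jacobi identity for all non-associative words. -/

namespace FreeLieSuper

open LieSuperalgebra

variable (𝕜 : Type*) [Field 𝕜] {X : Type*} (p : X → ZMod 2)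

/-- The degree of a non-associative word: the sum of the degrees of its letters. -/
def deg : FreeMagma X → ZMod 2
  | .of x => p x
  | .mul u v => deg u + deg v

/-- A word, as an element of the free non-associative algebra. -/
noncomputable def word (u : FreeMagma X) : FreeNonUnitalNonAssocAlgebra 𝕜 X :=
  MonoidAlgebra.single u 1

theorem word_mul (u v : FreeMagma X) : word 𝕜 u * word 𝕜 v = word 𝕜 (u * v) := by
  simp [word, MonoidAlgebra.single_mul_single]

/-- The defining relators. -/
inductive IsRelator : FreeNonUnitalNonAssocAlgebra 𝕜 X → Prop
  | antisymm (u v : FreeMagma X) :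
      IsRelator (word 𝕜 u * word 𝕜 v + superSign 𝕜 (deg p u) (deg p v) • (word 𝕜 v * word 𝕜 u))
  | jacobi (u v w : FreeMagma X) :
      IsRelator (superSign 𝕜 (deg p u) (deg p w) • (word 𝕜 u * (word 𝕜 v * word 𝕜 w))
        + superSign 𝕜 (deg p v) (deg p u) • (word 𝕜 v * (word 𝕜 w * word 𝕜 u))
        + superSign 𝕜 (deg p w) (deg p v) • (word 𝕜 w * (word 𝕜 u * word 𝕜 v)))

/-- The two-sided ideal generated by the relators. -/
noncomputable def relIdeal : Submodule 𝕜 (FreeNonUnitalNonAssocAlgebra 𝕜 X) :=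
  sInf {J | (∀ r, IsRelator 𝕜 p r → r ∈ J) ∧ ∀ x, ∀ y ∈ J, x * y ∈ J ∧ y * x ∈ J}

/-- The span of the words of degree `a` in the free non-associative algebra. -/
noncomputable def wordPart (a : ZMod 2) : Submodule 𝕜 (FreeNonUnitalNonAssocAlgebra 𝕜 X) :=
  Submodule.span 𝕜 {r | ∃ u : FreeMagma X, deg p u = a ∧ word 𝕜 u = r}

theorem relator_mem {r : FreeNonUnitalNonAssocAlgebra 𝕜 X} (h : IsRelator 𝕜 p r) :
    r ∈ relIdeal 𝕜 p :=
  (Submodule.mem_sInf).2 fun _ hJ => hJ.1 r h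

theorem mul_mem_relIdeal (x : FreeNonUnitalNonAssocAlgebra 𝕜 X) {y}
    (h : y ∈ relIdeal 𝕜 p) : x * y ∈ relIdeal 𝕜 p :=
  (Submodule.mem_sInf).2 fun J hJ => (hJ.2 x y ((Submodule.mem_sInf).1 h J hJ)).1

theorem relIdeal_mul_mem {x : FreeNonUnitalNonAssocAlgebra 𝕜 X} (y)
    (h : x ∈ relIdeal 𝕜 p) : x * y ∈ relIdeal 𝕜 p :=
  (Submodule.mem_sInf).2 fun J hJ => (hJ.2 y x ((Submodule.mem_sInf).1 h J hJ)).2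

theorem word_mem (u : FreeMagma X) : word 𝕜 u ∈ wordPart 𝕜 p (deg p u) :=
  Submodule.subset_span ⟨u, rfl, rfl⟩

theorem wordPart_mul {a b : ZMod 2} {x y : FreeNonUnitalNonAssocAlgebra 𝕜 X}
    (hx : x ∈ wordPart 𝕜 p a) (hy : y ∈ wordPart 𝕜 p b) : x * y ∈ wordPart 𝕜 p (a + b) := by
  induction hx, hy using Submodule.span_induction₂ with
  | mem_mem x y hx hy =>
    obtain ⟨u, rfl, rfl⟩ := hx
    obtain ⟨v, rfl, rfl⟩ := hy
    rw [word_mul]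
    exact word_mem 𝕜 p (u * v)
  | zero_left y hy => simp
  | zero_right x hx => simp
  | add_left x y z _ _ _ h1 h2 => rw [add_mul]; exact add_mem h1 h2
  | add_right x y z _ _ _ h1 h2 => rw [mul_add]; exact add_mem h1 h2
  | smul_left r x y _ _ h => rw [smul_mul_assoc]; exact Submodule.smul_mem _ _ h
  | smul_right r x y _ _ h => rw [mul_smul_comm]; exact Submodule.smul_mem _ _ h

theorem span_word : Submodule.span 𝕜 (Set.range (word 𝕜 (X := X))) = ⊤ := by
  rw [eq_top_iff]
  rintro x -
  induction x using MonoidAlgebra.induction_linear with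
  | zero => exact zero_mem _
  | add f g hf hg => exact add_mem hf hg
  | single u r =>
    have : (MonoidAlgebra.single u r : FreeNonUnitalNonAssocAlgebra 𝕜 X) = r • word 𝕜 u := by
      simp [word]
    rw [this]
    exact Submodule.smul_mem _ _ (Submodule.subset_span ⟨u, rfl⟩)

theorem zmod_two_cases (a : ZMod 2) : a = 0 ∨ a = 1 := by
  revert a; decide

theorem wordPart_le_sup (a : ZMod 2) : wordPart 𝕜 p a ≤ wordPart 𝕜 p 0 ⊔ wordPart 𝕜 p 1 := by
  rcases zmod_two_cases a with rfl | rfl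
  · exact le_sup_left
  · exact le_sup_right

theorem wordPart_isCompl : IsCompl (wordPart 𝕜 p 0) (wordPart 𝕜 p 1) := by
  have key : ∀ a : ZMod 2, ∀ x ∈ wordPart 𝕜 p a, ∀ u, x.coeff u ≠ 0 → deg p u = a := by
    intro a x hx
    induction hx using Submodule.span_induction with
    | mem x hx =>
      obtain ⟨v, rfl, rfl⟩ := hx
      intro u hu
      by_contra hne
      apply hu
      have : v ≠ u := fun h => hne (h ▸ rfl)
      simp [word, MonoidAlgebra.coeff_single, this]
    | zero => intro u hu; simp at hu
    | add x y _ _ h1 h2 =>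
      intro u hu
      by_cases h : x.coeff u = 0
      · exact h2 u (fun h' => hu (by simp [h, h']))
      · exact h1 u h
    | smul r x _ h =>
      intro u hu
      exact h u (fun h' => hu (by simp [h']))
  constructor
  · rw [Submodule.disjoint_def]
    intro x h0 h1
    ext u
    by_contra hu
    exact zero_ne_one ((key 0 x h0 u hu).symm.trans (key 1 x h1 u hu))
  · rw [codisjoint_iff, eq_top_iff, ← span_word 𝕜, Submodule.span_le]
    rintro _ ⟨u, rfl⟩
    exact wordPart_le_sup 𝕜 p _ (word_mem 𝕜 p u)

/-- The ideal of relations is graded. -/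
theorem relIdeal_graded : relIdeal 𝕜 p ≤
    (relIdeal 𝕜 p ⊓ wordPart 𝕜 p 0) ⊔ (relIdeal 𝕜 p ⊓ wordPart 𝕜 p 1) := by
  have hom : ∀ (a : ZMod 2) x, x ∈ relIdeal 𝕜 p → x ∈ wordPart 𝕜 p a →
      x ∈ (relIdeal 𝕜 p ⊓ wordPart 𝕜 p 0) ⊔ (relIdeal 𝕜 p ⊓ wordPart 𝕜 p 1) := by
    intro a x h1 h2
    rcases zmod_two_cases a with rfl | rfl
    · exact Submodule.mem_sup_left ⟨h1, h2⟩
    · exact Submodule.mem_sup_right ⟨h1, h2⟩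
  refine sInf_le ⟨?_, ?_⟩
  · intro r hr
    have hr' := relator_mem 𝕜 p hr
    cases hr with
    | antisymm u v =>
      refine hom (deg p u + deg p v) _ hr' (add_mem ?_ (Submodule.smul_mem _ _ ?_))
      · exact wordPart_mul 𝕜 p (word_mem 𝕜 p u) (word_mem 𝕜 p v)
      · rw [add_comm]
        exact wordPart_mul 𝕜 p (word_mem 𝕜 p v) (word_mem 𝕜 p u)
    | jacobi u v w =>
      have tri := fun u v w => wordPart_mul 𝕜 p (word_mem 𝕜 p u)
        (wordPart_mul 𝕜 p (word_mem 𝕜 p v) (word_mem 𝕜 p w))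
      refine hom (deg p u + (deg p v + deg p w)) _ hr' (add_mem (add_mem ?_ ?_) ?_) <;>
        apply Submodule.smul_mem
      · exact tri u v w
      · have := tri v w u
        rwa [show deg p v + (deg p w + deg p u) = deg p u + (deg p v + deg p w) by ring] at this
      · have := tri w u v
        rwa [show deg p w + (deg p u + deg p v) = deg p u + (deg p v + deg p w) by ring] at this
  · intro x y hy
    have hx : x ∈ wordPart 𝕜 p 0 ⊔ wordPart 𝕜 p 1 := by
      rw [(wordPart_isCompl 𝕜 p).sup_eq_top]; trivial
    obtain ⟨x0, hx0, x1, hx1, rfl⟩ := Submodule.mem_sup.1 hx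
    obtain ⟨y0, hy0, y1, hy1, rfl⟩ := Submodule.mem_sup.1 hy
    have l : ∀ {a b x y}, x ∈ wordPart 𝕜 p a → y ∈ relIdeal 𝕜 p ⊓ wordPart 𝕜 p b →
        x * y ∈ (relIdeal 𝕜 p ⊓ wordPart 𝕜 p 0) ⊔ (relIdeal 𝕜 p ⊓ wordPart 𝕜 p 1) :=
      fun hx hy => hom _ _ (mul_mem_relIdeal 𝕜 p _ hy.1) (wordPart_mul 𝕜 p hx hy.2)
    have r : ∀ {a b x y}, x ∈ wordPart 𝕜 p a → y ∈ relIdeal 𝕜 p ⊓ wordPart 𝕜 p b →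
        y * x ∈ (relIdeal 𝕜 p ⊓ wordPart 𝕜 p 0) ⊔ (relIdeal 𝕜 p ⊓ wordPart 𝕜 p 1) :=
      fun hx hy => hom _ _ (relIdeal_mul_mem 𝕜 p _ hy.1) (wordPart_mul 𝕜 p hy.2 hx)
    constructor
    · rw [add_mul, mul_add, mul_add]
      exact add_mem (add_mem (l hx0 hy0) (l hx0 hy1)) (add_mem (l hx1 hy0) (l hx1 hy1))
    · rw [add_mul, mul_add, mul_add]
      exact add_mem (add_mem (r hx0 hy0) (r hx1 hy0)) (add_mem (r hx0 hy1) (r hx1 hy1))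

end FreeLieSuper

/-- The free Lie superalgebra on the generators `X` with parities `p`. -/
abbrev FreeLieSuperalgebra (𝕜 : Type*) [Field 𝕜] {X : Type*} (p : X → ZMod 2) :=
  FreeNonUnitalNonAssocAlgebra 𝕜 X ⧸ FreeLieSuper.relIdeal 𝕜 p

namespace FreeLieSuper

open LieSuperalgebra

variable (𝕜 : Type*) [Field 𝕜] {X : Type*} (p : X → ZMod 2)

/-- The bracket: the product of the free non-associative algebra, on the quotient. -/
noncomputable def bracket :
    FreeLieSuperalgebra 𝕜 p →ₗ[𝕜] FreeLieSuperalgebra 𝕜 p →ₗ[𝕜] FreeLieSuperalgebra 𝕜 p :=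
  (relIdeal 𝕜 p).liftQ
    { toFun := fun x => (relIdeal 𝕜 p).mapQ (relIdeal 𝕜 p) (LinearMap.mulLeft 𝕜 x)
        fun _ hy => mul_mem_relIdeal 𝕜 p x hy
      map_add' := fun x y => by
        refine LinearMap.ext fun z => ?_
        obtain ⟨z, rfl⟩ := Submodule.Quotient.mk_surjective _ z
        exact congrArg (relIdeal 𝕜 p).mkQ (add_mul x y z)
      map_smul' := fun c x => by
        refine LinearMap.ext fun z => ?_
        obtain ⟨z, rfl⟩ := Submodule.Quotient.mk_surjective _ z
        exact congrArg (relIdeal 𝕜 p).mkQ (smul_mul_assoc c x z) }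
    fun x hx => by
      rw [LinearMap.mem_ker]
      refine LinearMap.ext fun z => ?_
      obtain ⟨z, rfl⟩ := Submodule.Quotient.mk_surjective _ z
      exact (Submodule.Quotient.mk_eq_zero _).2 (relIdeal_mul_mem 𝕜 p z hx)

theorem bracket_mk (x y : FreeNonUnitalNonAssocAlgebra 𝕜 X) :
    bracket 𝕜 p ((relIdeal 𝕜 p).mkQ x) ((relIdeal 𝕜 p).mkQ y) = (relIdeal 𝕜 p).mkQ (x * y) :=
  rfl

/-- The graded parts: the spans of the classes of the words of degree `a`. -/
noncomputable def gradedPart (a : ZMod 2) : Submodule 𝕜 (FreeLieSuperalgebra 𝕜 p) :=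
  (wordPart 𝕜 p a).map (relIdeal 𝕜 p).mkQ

theorem gradedPart_isCompl : IsCompl (gradedPart 𝕜 p 0) (gradedPart 𝕜 p 1) := by
  have hc := wordPart_isCompl 𝕜 p
  constructor
  · rw [Submodule.disjoint_def]
    rintro _ ⟨x, hx, rfl⟩ ⟨y, hy, hxy⟩
    have h : y - x ∈ relIdeal 𝕜 p := (Submodule.Quotient.eq _).1 hxy
    obtain ⟨i, hi, j, hj, hij⟩ := Submodule.mem_sup.1 (relIdeal_graded 𝕜 p h)
    have e : x + i = y - j := by
      rw [eq_sub_iff_add_eq, add_assoc, hij]; abel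
    have h0 : x + i = 0 := (Submodule.disjoint_def.1 hc.disjoint) _ (add_mem hx hi.2)
      (e ▸ sub_mem hy hj.2)
    have : x ∈ relIdeal 𝕜 p := by
      rw [eq_neg_of_add_eq_zero_left h0]; exact neg_mem hi.1
    exact (Submodule.Quotient.mk_eq_zero _).2 this
  · rw [codisjoint_iff, gradedPart, gradedPart, ← Submodule.map_sup, hc.sup_eq_top,
      Submodule.map_top, Submodule.range_mkQ]

theorem gradedPart_eq_span (a : ZMod 2) : gradedPart 𝕜 p a =
    Submodule.span 𝕜 {r | ∃ u, deg p u = a ∧ (relIdeal 𝕜 p).mkQ (word 𝕜 u) = r} := by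
  rw [gradedPart, wordPart, Submodule.map_span]
  congr 1
  ext r
  constructor
  · rintro ⟨_, ⟨u, hu, rfl⟩, rfl⟩
    exact ⟨u, hu, rfl⟩
  · rintro ⟨u, hu, rfl⟩
    exact ⟨_, ⟨u, hu, rfl⟩, rfl⟩

noncomputable instance : LieSuperalgebra 𝕜 (FreeLieSuperalgebra 𝕜 p) where
  part := gradedPart 𝕜 p
  isCompl_part := gradedPart_isCompl 𝕜 p
  br := bracket 𝕜 p
  br_mem := by
    rintro a b _ _ ⟨x, hx, rfl⟩ ⟨y, hy, rfl⟩
    exact ⟨x * y, wordPart_mul 𝕜 p hx hy, rfl⟩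
  br_antisymm := by
    intro a b x y hx hy
    rw [gradedPart_eq_span] at hx hy
    rw [eq_neg_iff_add_eq_zero]
    induction hx, hy using Submodule.span_induction₂ with
    | mem_mem x y hx hy =>
      obtain ⟨u, rfl, rfl⟩ := hx
      obtain ⟨v, rfl, rfl⟩ := hy
      rw [bracket_mk, bracket_mk, ← map_smul, ← map_add]
      exact (Submodule.Quotient.mk_eq_zero _).2 (relator_mem 𝕜 p (.antisymm u v))
    | zero_left y hy => simp
    | zero_right x hx => simp
    | add_left x y z _ _ _ h1 h2 =>
      simp only [map_add, LinearMap.add_apply, smul_add]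
      rw [add_add_add_comm, h1, h2, add_zero]
    | add_right x y z _ _ _ h1 h2 =>
      simp only [map_add, LinearMap.add_apply, smul_add]
      rw [add_add_add_comm, h1, h2, add_zero]
    | smul_left r x y _ _ h =>
      simp only [map_smul, LinearMap.smul_apply]
      rw [smul_comm _ r, ← smul_add, h, smul_zero]
    | smul_right r x y _ _ h =>
      simp only [map_smul, LinearMap.smul_apply]
      rw [smul_comm _ r, ← smul_add, h, smul_zero]
  br_jacobi := by
    intro a b c x y z hx hy hz
    rw [gradedPart_eq_span] at hx hy hz
    induction hx using Submodule.span_induction with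
    | mem x hx =>
      induction hy using Submodule.span_induction with
      | mem y hy =>
        induction hz using Submodule.span_induction with
        | mem z hz =>
          obtain ⟨u, rfl, rfl⟩ := hx
          obtain ⟨v, rfl, rfl⟩ := hy
          obtain ⟨w, rfl, rfl⟩ := hz
          simp only [bracket_mk]
          rw [← map_smul, ← map_smul, ← map_smul, ← map_add, ← map_add]
          exact (Submodule.Quotient.mk_eq_zero _).2 (relator_mem 𝕜 p (.jacobi u v w))
        | zero => simp
        | add z w _ _ h1 h2 =>
          rw [← add_zero (0 : FreeLieSuperalgebra 𝕜 p)]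
          nth_rewrite 1 [← h1]
          rw [← h2]
          simp only [map_add, LinearMap.add_apply, smul_add]
          abel
        | smul r z _ h =>
          rw [← smul_zero r, ← h]
          simp only [map_smul, LinearMap.smul_apply, smul_add, smul_comm r]
      | zero => simp
      | add z w _ _ h1 h2 =>
        rw [← add_zero (0 : FreeLieSuperalgebra 𝕜 p)]
        nth_rewrite 1 [← h1]
        rw [← h2]
        simp only [map_add, LinearMap.add_apply, smul_add]
        abel
      | smul r z _ h =>
        rw [← smul_zero r, ← h]
        simp only [map_smul, LinearMap.smul_apply, smul_add, smul_comm r]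
    | zero => simp
    | add z w _ _ h1 h2 =>
      rw [← add_zero (0 : FreeLieSuperalgebra 𝕜 p)]
      nth_rewrite 1 [← h1]
      rw [← h2]
      simp only [map_add, LinearMap.add_apply, smul_add]
      abel
    | smul r z _ h =>
      rw [← smul_zero r, ← h]
      simp only [map_smul, LinearMap.smul_apply, smul_add, smul_comm r]

/-! The universal property, and the existence of free presentations. -/

/-- The generators. -/
noncomputable def of (x : X) : FreeLieSuperalgebra 𝕜 p :=
  (relIdeal 𝕜 p).mkQ (word 𝕜 (FreeMagma.of x))

section Lift

variable {𝕜 p} {K : Type*} [AddCommGroup K] [Module 𝕜 K] [LieSuperalgebra 𝕜 K]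

/-- The value of a non-associative word under an assignment of its letters. -/
def evalWord (𝕜 : Type*) [Field 𝕜] [Module 𝕜 K] [LieSuperalgebra 𝕜 K] (f : X → K) :
    FreeMagma X → K
  | .of x => f x
  | .mul u v => br 𝕜 (evalWord 𝕜 f u) (evalWord 𝕜 f v)

/-- Every parity-preserving map from the generators to a Lie superalgebra extends uniquely to a
homomorphism. -/
theorem existsUnique_lift (f : X → K) (hf : ∀ x, f x ∈ (part (p x) : Submodule 𝕜 K)) :
    ∃! φ : Hom 𝕜 (FreeLieSuperalgebra 𝕜 p) K, ∀ x, φ.toLinearMap (of 𝕜 p x) = f x := by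
  let g : FreeNonUnitalNonAssocAlgebra 𝕜 X →ₗ[𝕜] K :=
    (Finsupp.lsum ℕ fun u => LinearMap.toSpanSingleton 𝕜 K (evalWord 𝕜 f u)) ∘ₗ
      (MonoidAlgebra.coeffLinearEquiv 𝕜).toLinearMap
  have gw : ∀ u, g (word 𝕜 u) = evalWord 𝕜 f u := by
    intro u; simp [g, word]
  have gm : ∀ x y, g (x * y) = br 𝕜 (g x) (g y) := by
    intro x y
    have hx : x ∈ Submodule.span 𝕜 (Set.range (word 𝕜 (X := X))) := by rw [span_word]; trivial
    have hy : y ∈ Submodule.span 𝕜 (Set.range (word 𝕜 (X := X))) := by rw [span_word]; trivial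
    induction hx, hy using Submodule.span_induction₂ with
    | mem_mem x y hx hy =>
      obtain ⟨u, rfl⟩ := hx
      obtain ⟨v, rfl⟩ := hy
      rw [word_mul, gw, gw, gw]
      rfl
    | zero_left y hy => simp
    | zero_right x hx => simp
    | add_left x y z _ _ _ h1 h2 => simp [add_mul, h1, h2]
    | add_right x y z _ _ _ h1 h2 => simp [mul_add, h1, h2]
    | smul_left r x y _ _ h => rw [smul_mul_assoc, map_smul, map_smul, map_smul, h]; rfl
    | smul_right r x y _ _ h => rw [mul_smul_comm, map_smul, map_smul, map_smul, h]
  have gp : ∀ u, evalWord 𝕜 f u ∈ (part (deg p u) : Submodule 𝕜 K) := by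
    intro u
    induction u with
    | ih1 x => exact hf x
    | ih2 u v hu hv => exact br_mem hu hv
  have gI : relIdeal 𝕜 p ≤ LinearMap.ker g := by
    refine sInf_le ⟨?_, ?_⟩
    · intro r hr
      rw [LinearMap.mem_ker]
      cases hr with
      | antisymm u v =>
        simp only [map_add, map_smul, gm, gw]
        rw [← eq_neg_iff_add_eq_zero]
        exact br_antisymm (gp u) (gp v)
      | jacobi u v w =>
        simp only [map_add, map_smul, gm, gw]
        exact br_jacobi (gp u) (gp v) (gp w)
    · intro x y hy
      rw [LinearMap.mem_ker] at hy
      simp [gm, hy]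
  refine ⟨⟨(relIdeal 𝕜 p).liftQ g gI, ?_, ?_⟩, ?_, ?_⟩
  · intro a x hx
    change x ∈ gradedPart 𝕜 p a at hx
    rw [gradedPart_eq_span] at hx
    change x ∈ (part a : Submodule 𝕜 K).comap ((relIdeal 𝕜 p).liftQ g gI)
    refine Submodule.span_le.2 ?_ hx
    rintro _ ⟨u, rfl, rfl⟩
    change g (word 𝕜 u) ∈ (part (deg p u) : Submodule 𝕜 K)
    rw [gw]; exact gp u
  · intro x y
    obtain ⟨x, rfl⟩ := Submodule.mkQ_surjective _ x
    obtain ⟨y, rfl⟩ := Submodule.mkQ_surjective _ y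
    exact gm x y
  · intro x
    exact gw (.of x)
  · intro φ hφ
    have h : ∀ u, φ.toLinearMap ((relIdeal 𝕜 p).mkQ (word 𝕜 u)) = evalWord 𝕜 f u := by
      intro u
      induction u with
      | ih1 x => exact hφ x
      | ih2 u v hu hv =>
        have := φ.map_br ((relIdeal 𝕜 p).mkQ (word 𝕜 u)) ((relIdeal 𝕜 p).mkQ (word 𝕜 v))
        have e : br 𝕜 ((relIdeal 𝕜 p).mkQ (word 𝕜 u)) ((relIdeal 𝕜 p).mkQ (word 𝕜 v)) =
            (relIdeal 𝕜 p).mkQ (word 𝕜 (FreeMagma.mul u v)) :=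
          congrArg (relIdeal 𝕜 p).mkQ (word_mul 𝕜 u v)
        rw [e] at this
        refine this.trans ?_
        change br 𝕜 (φ.toLinearMap _) (φ.toLinearMap _) = _
        rw [hu, hv]
        rfl
    have hl : φ.toLinearMap = (relIdeal 𝕜 p).liftQ g gI := by
      refine Submodule.linearMap_qext _ (LinearMap.ext_on_range (span_word 𝕜) fun u => ?_)
      exact (h u).trans (gw u).symm
    cases φ
    congr

end Lift

end FreeLieSuper

namespace LieSuperalgebra

universe w

/-- A free presentation `0 → R → F → L → 0`: a free Lie superalgebra `F` on a set of generators
with parities, and a surjective homomorphism `π : F → L`; then `R = ker π`. -/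
structure FreePresentation (𝕜 : Type*) (L : Type*) [Field 𝕜] [AddCommGroup L] [Module 𝕜 L]
    [LieSuperalgebra 𝕜 L] where
  X : Type w
  parity : X → ZMod 2
  π : Hom 𝕜 (FreeLieSuperalgebra 𝕜 parity) L
  surjective : Function.Surjective π.toLinearMap

/-- Every Lie superalgebra has a free presentation. -/
theorem FreePresentation.nonempty (𝕜 : Type*) (L : Type w) [Field 𝕜] [AddCommGroup L]
    [Module 𝕜 L] [LieSuperalgebra 𝕜 L] : Nonempty (FreePresentation.{w} 𝕜 L) := by
  obtain ⟨φ, hφ, -⟩ := FreeLieSuper.existsUnique_lift (𝕜 := 𝕜)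
    (X := Σ a : ZMod 2, ↥(part a : Submodule 𝕜 L)) (p := fun x => x.1)
    (fun x => (x.2 : L)) (fun x => x.2.2)
  refine ⟨⟨_, _, φ, fun y => ?_⟩⟩
  have hy : y ∈ (part 0 : Submodule 𝕜 L) ⊔ part 1 := by
    rw [isCompl_part.sup_eq_top]; trivial
  obtain ⟨u, hu, v, hv, rfl⟩ := Submodule.mem_sup.1 hy
  refine ⟨FreeLieSuper.of 𝕜 _ ⟨0, u, hu⟩ + FreeLieSuper.of 𝕜 _ ⟨1, v, hv⟩, ?_⟩
  rw [map_add, hφ, hφ]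

namespace FreePresentation

variable {𝕜 : Type*} {L : Type*} [Field 𝕜] [AddCommGroup L] [Module 𝕜 L] [LieSuperalgebra 𝕜 L]
  (P : FreePresentation.{w} 𝕜 L)

abbrev F := FreeLieSuperalgebra 𝕜 P.parity

noncomputable def R : Submodule 𝕜 P.F := LinearMap.ker P.π.toLinearMap

/-- The graded ideal `S` of `F` with `S / R ≅ N`: the preimage of `N`. -/
noncomputable def S (N : Submodule 𝕜 L) : Submodule 𝕜 P.F := N.comap P.π.toLinearMap

/-- The Schur multiplier of the pair, `M(N, L) = (R ∩ [S, F]) / [R, F]`. -/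
abbrev SchurMultiplier (N : Submodule 𝕜 L) :=
  ↥(P.R ⊓ commutator 𝕜 (P.S N) ⊤) ⧸
    (commutator 𝕜 P.R ⊤).submoduleOf (P.R ⊓ commutator 𝕜 (P.S N) ⊤)

end FreePresentation

end LieSuperalgebra

/-! Write `Q = [S,F]/[R,F]`. Projecting to `L` gives an exact sequence `0 → M(N,L) → Q → [N,L] → 0`,
so `dim M(N,L) + dim [N,L] = dim Q` (`finrank_schurMultiplier_add`). The bracket of `F` modulo
`[R,F]` depends only on images in `L`, hence is a super-antisymmetric form `β` on `L`
(`exists_form`), and `Q` is spanned by `β(N, L)`. Thus `Q` is a quotient of the super exterior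
product `N ∧ L`, whose dimension `w` is the number in the hypothesis before subtracting one
(`two_mul_card_wedgeIndex`). The hypothesis reads `dim M(N,L) = w - 1`, which forces `dim [N,L] ≤
1`.

If `L` were abelian, the central extension of `L` by its super exterior square would show that `Q`
has full dimension `w` (`exists_comp_form_eq_wedgeForm`). Since `[N,L] = 0`, this would give `dim
M(N,L) = w`, a contradiction.

If `[N,L] ≠ 0`, then `dim [N,L] = 1` and `dim Q = w`, so `β` on `N × L` carries no relations beyond
super-antisymmetry. Nilpotency makes `[N,L]` central. Conversely, for homogeneous `z` in `Z(N,L)`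
and a homogeneous nonzero bracket `[x,y]`, the Jacobi identity gives `β(z,[x,y]) = 0`
(`form_central_br`). Hence `z ∧ [x,y] = 0`, and `z` is a multiple of `[x,y]`. -/

theorem superSign_comm {𝕜 : Type*} [Field 𝕜] (a b : ZMod 2) :
    superSign 𝕜 a b = superSign 𝕜 b a := by
  simp [superSign, mul_comm]

theorem superSign_mul_self {𝕜 : Type*} [Field 𝕜] (a b : ZMod 2) :
    superSign 𝕜 a b * superSign 𝕜 a b = 1 := by
  simp [superSign, ← mul_pow]

theorem superSign_ne_zero {𝕜 : Type*} [Field 𝕜] (a b : ZMod 2) : superSign 𝕜 a b ≠ 0 := by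
  simp [superSign]

/-! ### Homogeneous bases adapted to a graded subspace. -/

section Linear

variable {𝕜 : Type*} [Field 𝕜] {L : Type*} [AddCommGroup L] [Module 𝕜 L]

/-- A homogeneous basis of `L` (`V a` being the part of degree `a`) that contains a basis
of the graded subspace `N`. -/
theorem exists_graded_basis [FiniteDimensional 𝕜 L] {V : ZMod 2 → Submodule 𝕜 L}
    (hV : IsCompl (V 0) (V 1)) {N : Submodule 𝕜 L} (hN : N = (N ⊓ V 0) ⊔ (N ⊓ V 1)) :
    ∃ (s : Set L) (b : Module.Basis s 𝕜 L) (p : s → ZMod 2) (J : Set s),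
      (∀ i, b i ∈ V (p i)) ∧ N = Submodule.span 𝕜 (b '' J) ∧
      (∀ a, {i ∈ J | p i = a}.ncard = Module.finrank 𝕜 ↥(N ⊓ V a)) := by
  classical
  have step : ∀ a, ∃ s t : Set L, s ⊆ t ∧ s ⊆ (N ⊓ V a : Submodule 𝕜 L) ∧ t ⊆ V a ∧
      Submodule.span 𝕜 s = N ⊓ V a ∧ Submodule.span 𝕜 t = V a ∧
      LinearIndepOn 𝕜 id s ∧ LinearIndepOn 𝕜 id t := by
    intro a
    -- In each degree a basis `s` of `N ⊓ V a` is extended to a basis `t` inside `V a`, so every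
    -- vector stays homogeneous.
    obtain ⟨s, hs, hsp, hli⟩ := exists_linearIndependent 𝕜 ((N ⊓ V a : Submodule 𝕜 L) : Set L)
    have hs' : s ⊆ (V a : Set L) := hs.trans fun x hx => hx.2
    obtain ⟨t, ht, hst, hspt, htli⟩ := exists_linearIndepOn_id_extension
      (show LinearIndepOn 𝕜 id s from hli) hs'
    refine ⟨s, t, hst, hs, ht, by rw [hsp, Submodule.span_eq], ?_, hli, htli⟩
    exact le_antisymm (Submodule.span_le.2 ht) hspt
  choose s t hst hsN htV hsps hspt hsli htli using step
  have hli : LinearIndepOn 𝕜 id (t 0 ∪ t 1) :=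
    (htli 0).id_union (htli 1) (by rw [hspt, hspt]; exact hV.disjoint)
  have htop : Submodule.span 𝕜 (t 0 ∪ t 1) = ⊤ := by
    rw [Submodule.span_union, hspt, hspt, hV.sup_eq_top]
  let b : Module.Basis ↥(t 0 ∪ t 1) 𝕜 L := Module.Basis.mk
    (show LinearIndependent 𝕜 ((↑) : ↥(t 0 ∪ t 1) → L) from hli) (by
      rw [Subtype.range_coe, htop])
  have hb : ∀ i, b i = (i : L) := fun i => by simp [b]
  have hmem : ∀ a, ∀ x ∈ t a, x ∈ t 0 ∪ t 1 := by
    intro a x hx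
    rcases FreeLieSuper.zmod_two_cases a with rfl | rfl
    · exact Or.inl hx
    · exact Or.inr hx
  have hdisj : ∀ x, x ∈ t 0 ∪ t 1 → x ∈ V 0 → x ∈ V 1 → False := by
    intro x hx h0 h1
    have h := Submodule.disjoint_def.1 hV.disjoint x h0 h1
    exact hli.ne_zero hx h
  let p : ↥(t 0 ∪ t 1) → ZMod 2 := fun i => if (i : L) ∈ t 0 then 0 else 1
  have hp : ∀ a (i : ↥(t 0 ∪ t 1)), (i : L) ∈ t a → p i = a := by
    intro a i hi
    rcases FreeLieSuper.zmod_two_cases a with rfl | rfl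
    · simp [p, hi]
    · have : (i : L) ∉ t 0 := fun h => hdisj _ i.2 (htV 0 h) (htV 1 hi)
      simp [p, this]
  have hpt : ∀ i : ↥(t 0 ∪ t 1), (i : L) ∈ t (p i) := by
    intro i
    rcases i.2 with h | h
    · rw [hp 0 i h]; exact h
    · rw [hp 1 i h]; exact h
  refine ⟨t 0 ∪ t 1, b, p, {i | (i : L) ∈ s 0 ∪ s 1}, ?_, ?_, ?_⟩
  · intro i
    rw [hb]
    exact htV _ (hpt i)
  · have : b '' {i | (i : L) ∈ s 0 ∪ s 1} = s 0 ∪ s 1 := by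
      ext x
      constructor
      · rintro ⟨i, hi, rfl⟩
        rw [hb]; exact hi
      · intro hx
        exact ⟨⟨x, Set.union_subset_union (hst 0) (hst 1) hx⟩, hx, hb _⟩
    rw [this, Submodule.span_union, hsps, hsps]
    exact hN
  · intro a
    have e : (fun i : ↥(t 0 ∪ t 1) => (i : L)) '' {i | i ∈ {i : ↥(t 0 ∪ t 1) | (i : L) ∈ s 0 ∪ s 1} ∧ p i = a} = s a := by
      ext x
      constructor
      · rintro ⟨i, ⟨hi, rfl⟩, rfl⟩
        rcases hi with h | h
        · rw [hp 0 i (hst 0 h)]; exact h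
        · rw [hp 1 i (hst 1 h)]; exact h
      · intro hx
        refine ⟨⟨x, hmem a x (hst a hx)⟩, ⟨?_, hp a _ (hst a hx)⟩, rfl⟩
        rcases FreeLieSuper.zmod_two_cases a with rfl | rfl
        · exact Or.inl hx
        · exact Or.inr hx
    rw [← hsps a, ← Set.ncard_image_of_injective _ Subtype.val_injective]
    refine (congrArg Set.ncard e).trans ?_
    have hfin : (s a).Finite := (show LinearIndependent 𝕜 ((↑) : s a → L) from hsli a).setFinite
    have := hfin.fintype
    rw [finrank_span_set_eq_card (hsli a), Set.ncard_eq_toFinset_card']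

/-! ### The super exterior product in coordinates. -/

variable {ι : Type*}

open Classical in
/-- The index pairs `(i, j)` for which the elements `b i ∧ b j` form a basis of `N ∧ L`. -/
noncomputable def wedgeIndex [Fintype ι] [LinearOrder ι] (p : ι → ZMod 2) (J : Set ι) : Finset (ι × ι) :=
  {t | t.1 ∈ J ∧ (t.2 ∉ J ∨ t.1 < t.2 ∨ (t.1 = t.2 ∧ p t.1 = 1))}

theorem mem_wedgeIndex [Fintype ι] [LinearOrder ι] {p : ι → ZMod 2} {J : Set ι} {t : ι × ι} :
    t ∈ wedgeIndex p J ↔ t.1 ∈ J ∧ (t.2 ∉ J ∨ t.1 < t.2 ∨ (t.1 = t.2 ∧ p t.1 = 1)) := by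
  simp [wedgeIndex]

/-- The index set splits into the pairs `i < j` in `J`, the odd diagonal of `J`, and `J × Jᶜ`;
swapping shows that the first piece is half of the off-diagonal of `J × J`. The doubled, rearranged
form avoids division and subtraction in `ℕ`. -/
theorem two_mul_card_wedgeIndex [Fintype ι] [LinearOrder ι] (p : ι → ZMod 2) (J : Set ι) :
    2 * (wedgeIndex p J).card + J.ncard =
      J.ncard ^ 2 + 2 * {i ∈ J | p i = 1}.ncard + 2 * (J.ncard * Jᶜ.ncard) := by
  classical
  let A : Finset ι := {i | i ∈ J}
  let U : Finset (ι × ι) := {t | t.1 ∈ J ∧ t.2 ∈ J ∧ t.1 < t.2}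
  let U' : Finset (ι × ι) := {t | t.1 ∈ J ∧ t.2 ∈ J ∧ t.2 < t.1}
  let O : Finset ι := {i | i ∈ J ∧ p i = 1}
  have hJ : J.ncard = A.card := by
    rw [Set.ncard_eq_toFinset_card']; congr 1; ext; simp [A]
  have hJc : Jᶜ.ncard = Aᶜ.card := by
    rw [Set.ncard_eq_toFinset_card']; congr 1; ext; simp [A]
  have hO : {i ∈ J | p i = 1}.ncard = O.card := by
    rw [Set.ncard_eq_toFinset_card']; congr 1; ext; simp [O]
  have hU : U'.card = U.card := by
    refine Finset.card_bij' (fun t _ => t.swap) (fun t _ => t.swap) ?_ ?_ ?_ ?_ <;>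
      simp +contextual [U, U']
  have hoff : A.offDiag = U ∪ U' := by
    ext ⟨i, j⟩
    simp only [Finset.mem_offDiag, Finset.mem_union, Finset.mem_filter, Finset.mem_univ, true_and,
      A, U, U', ne_eq]
    constructor
    · rintro ⟨hi, hj, h⟩
      rcases lt_or_gt_of_ne h with h | h
      · exact Or.inl ⟨hi, hj, h⟩
      · exact Or.inr ⟨hi, hj, h⟩
    · rintro (⟨hi, hj, h⟩ | ⟨hi, hj, h⟩)
      · exact ⟨hi, hj, h.ne⟩
      · exact ⟨hi, hj, h.ne'⟩
  have hUU : Disjoint U U' := by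
    rw [Finset.disjoint_left]
    intro t h1 h2
    simp only [U, U', Finset.mem_filter] at h1 h2
    exact lt_asymm h1.2.2.2 h2.2.2.2
  have hcard := A.offDiag_card
  rw [hoff, Finset.card_union_of_disjoint hUU, hU] at hcard
  have hT : wedgeIndex p J = (U ∪ O.image fun i => (i, i)) ∪ A ×ˢ Aᶜ := by
    ext ⟨i, j⟩
    simp only [mem_wedgeIndex, Finset.mem_union, Finset.mem_image, Finset.mem_product,
      Finset.mem_compl, Finset.mem_filter, Finset.mem_univ, true_and, U, O, A, Prod.mk.injEq]
    constructor
    · rintro ⟨hi, h⟩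
      by_cases hj : j ∈ J
      · rcases h with h | h | ⟨rfl, h⟩
        · exact absurd hj h
        · exact Or.inl (Or.inl ⟨hi, hj, h⟩)
        · exact Or.inl (Or.inr ⟨i, ⟨hi, h⟩, rfl, rfl⟩)
      · exact Or.inr ⟨hi, hj⟩
    · rintro ((⟨hi, hj, h⟩ | ⟨k, ⟨hk, h⟩, rfl, rfl⟩) | ⟨hi, hj⟩)
      · exact ⟨hi, Or.inr (Or.inl h)⟩
      · exact ⟨hk, Or.inr (Or.inr ⟨rfl, h⟩)⟩
      · exact ⟨hi, Or.inl hj⟩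
  have hd1 : Disjoint U (O.image fun i => (i, i)) := by
    rw [Finset.disjoint_left]
    intro t h1 h2
    obtain ⟨i, -, rfl⟩ := Finset.mem_image.1 h2
    simp [U] at h1
  have hd2 : Disjoint (U ∪ O.image fun i => (i, i)) (A ×ˢ Aᶜ) := by
    rw [Finset.disjoint_left]
    rintro ⟨i, j⟩ h1 h2
    simp only [Finset.mem_product, Finset.mem_compl, Finset.mem_filter, Finset.mem_univ, true_and,
      A] at h2
    rcases Finset.mem_union.1 h1 with h | h
    · simp only [U, Finset.mem_filter] at h
      exact h2.2 h.2.2.1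
    · obtain ⟨k, -, h⟩ := Finset.mem_image.1 h
      simp only [Prod.mk.injEq] at h
      exact h2.2 (h.2 ▸ h.1 ▸ h2.1)
  rw [hT, Finset.card_union_of_disjoint hd2, Finset.card_union_of_disjoint hd1,
    Finset.card_image_of_injective _ (fun i j h => (Prod.mk.inj h).1), Finset.card_product,
    hJ, hJc, hO]
  -- `Finset.offDiag_card` uses truncated subtraction; this bound makes it exact.
  have : A.card ≤ A.card * A.card := Nat.le_mul_self _
  rw [pow_two]
  omega

/-- The universal super-antisymmetric form in the coordinates of a homogeneous basis. -/
noncomputable def wedgeForm (b : Module.Basis ι 𝕜 L) (p : ι → ZMod 2) :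
    L →ₗ[𝕜] L →ₗ[𝕜] (ι → ι → 𝕜) :=
  LinearMap.mk₂ 𝕜
    (fun x y i j => b.repr x i * b.repr y j - superSign 𝕜 (p i) (p j) * (b.repr x j * b.repr y i))
    (fun x x' y => by ext i j; simp; ring)
    (fun c x y => by ext i j; simp; ring)
    (fun x y y' => by ext i j; simp; ring)
    (fun c x y => by ext i j; simp; ring)

theorem wedgeForm_apply (b : Module.Basis ι 𝕜 L) (p : ι → ZMod 2) (x y : L) (i j : ι) :
    wedgeForm b p x y i j =
      b.repr x i * b.repr y j - superSign 𝕜 (p i) (p j) * (b.repr x j * b.repr y i) := rfl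

/-- The `(i, j)` coordinate isolates the term indexed by `(i, j)`: a pair and its swap never both
lie in `wedgeIndex` unless they coincide. The surviving coefficient is `1` off the diagonal and `1 -
(-1) = 2` on the odd diagonal, hence the need for `2 ≠ 0`. -/
theorem linearIndependent_wedgeForm [Fintype ι] [LinearOrder ι] (h2 : (2 : 𝕜) ≠ 0) (b : Module.Basis ι 𝕜 L)
    (p : ι → ZMod 2) (J : Set ι) :
    LinearIndependent 𝕜 fun t : wedgeIndex p J => wedgeForm b p (b t.1.1) (b t.1.2) := by
  rw [Fintype.linearIndependent_iff]
  rintro g hg ⟨⟨i, j⟩, ht⟩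
  have h := congrFun (congrFun hg i) j
  simp only [Finset.sum_apply, Pi.smul_apply, smul_eq_mul, Pi.zero_apply] at h
  rw [Finset.sum_eq_single ⟨(i, j), ht⟩] at h
  · refine (mul_eq_zero.1 h).resolve_right ?_
    rw [mem_wedgeIndex] at ht
    by_cases hij : i = j
    · subst hij
      have hp : p i = 1 := by simpa using ht.2.resolve_left (not_not.2 ht.1)
      simp [wedgeForm_apply, hp, superSign, ZMod.val_one]
      rwa [one_add_one_eq_two]
    · simp [wedgeForm_apply, hij]
  · rintro ⟨⟨k, l⟩, hkl⟩ - hne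
    have hne' : ¬ (k = i ∧ l = j) := by
      rintro ⟨rfl, rfl⟩; exact hne rfl
    rw [mem_wedgeIndex] at ht hkl
    have h1 : ¬ (k = j ∧ l = i) := by
      rintro ⟨rfl, rfl⟩
      simp only [ht.1, hkl.1, not_true, false_or, true_and] at ht hkl
      rcases ht with h | ⟨h, -⟩
      · rcases hkl with h' | ⟨h', -⟩
        · exact lt_asymm h h'
        · exact h.ne' h'
      · exact hne' ⟨h.symm, h⟩
    have e1 : b.repr (b k) i * b.repr (b l) j = 0 := by
      by_contra hc
      refine hne' ⟨?_, ?_⟩ <;> by_contra hk <;> simp [Finsupp.single_apply, hk] at hc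
    have e2 : b.repr (b k) j * b.repr (b l) i = 0 := by
      by_contra hc
      refine h1 ⟨?_, ?_⟩ <;> by_contra hk <;> simp [Finsupp.single_apply, hk] at hc
    simp [wedgeForm_apply, -Module.Basis.repr_self, e1, e2]
  · simp

/-- The part of the basis expansion outside degree `a` lies in both graded components, so it
vanishes. This is what lets coordinate signs be replaced by signs of degrees. -/
theorem repr_eq_zero_of_mem [Fintype ι] {V : ZMod 2 → Submodule 𝕜 L} (hV : IsCompl (V 0) (V 1))
    {b : Module.Basis ι 𝕜 L} {p : ι → ZMod 2} (hb : ∀ i, b i ∈ V (p i)) {a : ZMod 2} {x : L}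
    (hx : x ∈ V a) {i : ι} (hi : p i ≠ a) : b.repr x i = 0 := by
  classical
  have hd : Disjoint (V a) (V (a + 1)) := by
    rcases FreeLieSuper.zmod_two_cases a with rfl | rfl
    · exact hV.disjoint
    · exact hV.disjoint.symm
  have hp : ∀ i, p i ≠ a → p i = a + 1 := by
    intro i; exact (by decide : ∀ q a : ZMod 2, q ≠ a → q = a + 1) _ _
  have hs := b.sum_repr x
  rw [← Finset.sum_filter_add_sum_filter_not Finset.univ (fun i => p i = a)] at hs
  have m0 : ∑ i with p i = a, b.repr x i • b i ∈ V a :=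
    Submodule.sum_mem _ fun i hi => Submodule.smul_mem _ _ (by
      have := hb i; rwa [(Finset.mem_filter.1 hi).2] at this)
  have m1 : ∑ i with ¬ p i = a, b.repr x i • b i ∈ V (a + 1) :=
    Submodule.sum_mem _ fun i hi => Submodule.smul_mem _ _ (by
      have := hb i; rwa [hp i (Finset.mem_filter.1 hi).2] at this)
  have z : ∑ i with ¬ p i = a, b.repr x i • b i = 0 := by
    refine Submodule.disjoint_def.1 hd _ ?_ m1
    rw [← eq_sub_iff_add_eq'] at hs
    rw [hs]; exact sub_mem hx m0
  have := linearIndependent_iff'.1 b.linearIndependent _ _ z i (by simp [hi])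
  exact this

/-- Fix `k` with `w_k ≠ 0`. The `(i, k)` coordinates of `z ∧ w = 0` say `z_i w_k = ± z_k w_i`. By
homogeneity the sign is the same for all `i` where the right side is nonzero, so `z` is proportional
to `w`. -/
theorem mem_span_singleton_of_wedgeForm_eq_zero [Fintype ι] {V : ZMod 2 → Submodule 𝕜 L}
    (hV : IsCompl (V 0) (V 1)) {b : Module.Basis ι 𝕜 L} {p : ι → ZMod 2}
    (hb : ∀ i, b i ∈ V (p i)) {a c : ZMod 2} {z w : L} (hz : z ∈ V a) (hw : w ∈ V c)
    (hw0 : w ≠ 0) (h : wedgeForm b p z w = 0) : z ∈ Submodule.span 𝕜 {w} := by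
  obtain ⟨k, hk⟩ : ∃ k, b.repr w k ≠ 0 := by
    by_contra! hc
    exact hw0 (b.repr.map_eq_zero_iff.1 (Finsupp.ext hc))
  rw [Submodule.mem_span_singleton]
  refine ⟨superSign 𝕜 c a * b.repr z k / b.repr w k, ?_⟩
  apply b.repr.injective
  ext i
  have hi := congrFun (congrFun h i) k
  rw [wedgeForm_apply, Pi.zero_apply, Pi.zero_apply, sub_eq_zero] at hi
  have e : superSign 𝕜 (p i) (p k) * (b.repr z k * b.repr w i) =
      superSign 𝕜 c a * (b.repr z k * b.repr w i) := by
    by_cases hpk : p k = a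
    · by_cases hpi : p i = c
      · rw [hpk, hpi]
      · simp [repr_eq_zero_of_mem hV hb hw hpi]
    · simp [repr_eq_zero_of_mem hV hb hz hpk]
  rw [e] at hi
  simp only [map_smul, Finsupp.smul_apply, smul_eq_mul]
  field_simp
  rw [mul_assoc, ← hi, mul_comm]

section Form

variable {V : ZMod 2 → Submodule 𝕜 L} {G : Type*} [AddCommGroup G] [Module 𝕜 G]
  {β : L →ₗ[𝕜] L →ₗ[𝕜] G}

/-- The values of a super-antisymmetric form on `N × L` are determined by the pairs in
`wedgeIndex`. -/
theorem form_mem_of_wedgeIndex [Fintype ι] [LinearOrder ι] {N : Submodule 𝕜 L} (h2 : (2 : 𝕜) ≠ 0)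
    (hβ : ∀ {a c x y}, x ∈ V a → y ∈ V c → β x y = -(superSign 𝕜 a c • β y x))
    {b : Module.Basis ι 𝕜 L} {p : ι → ZMod 2} {J : Set ι} (hb : ∀ i, b i ∈ V (p i))
    (hN : N = Submodule.span 𝕜 (b '' J)) (Q : Submodule 𝕜 G)
    (h : ∀ t ∈ wedgeIndex p J, β (b t.1) (b t.2) ∈ Q) {x y : L} (hx : x ∈ N) : β x y ∈ Q := by
  subst hN
  have key : ∀ i ∈ J, ∀ j, β (b i) (b j) ∈ Q := by
    intro i hi j
    by_cases hj : j ∈ J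
    · rcases lt_trichotomy i j with hij | rfl | hij
      · exact h (i, j) (mem_wedgeIndex.2 ⟨hi, Or.inr (Or.inl hij)⟩)
      · rcases FreeLieSuper.zmod_two_cases (p i) with hp | hp
        · have e := hβ (hb i) (hb i)
          rw [hp, superSign, ZMod.val_zero, zero_mul, pow_zero, one_smul,
            eq_neg_iff_add_eq_zero, ← two_smul 𝕜] at e
          rw [(smul_eq_zero.1 e).resolve_left h2]
          exact zero_mem _
        · exact h (i, i) (mem_wedgeIndex.2 ⟨hi, Or.inr (Or.inr ⟨rfl, hp⟩)⟩)
      · rw [hβ (hb i) (hb j)]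
        exact neg_mem (Submodule.smul_mem _ _
          (h (j, i) (mem_wedgeIndex.2 ⟨hj, Or.inr (Or.inl hij)⟩)))
    · exact h (i, j) (mem_wedgeIndex.2 ⟨hi, Or.inl hj⟩)
  have hy : y ∈ Submodule.span 𝕜 (Set.range b) := by rw [b.span_eq]; trivial
  induction hx, hy using Submodule.span_induction₂ with
  | mem_mem x y hx hy =>
    obtain ⟨i, hi, rfl⟩ := hx
    obtain ⟨j, rfl⟩ := hy
    exact key i hi j
  | zero_left y hy => simp
  | zero_right x hx => simp
  | add_left x y z _ _ _ h1 h2 => simpa using add_mem h1 h2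
  | add_right x y z _ _ _ h1 h2 => simpa using add_mem h1 h2
  | smul_left r x y _ _ h => simpa using Submodule.smul_mem _ r h
  | smul_right r x y _ _ h => simpa using Submodule.smul_mem _ r h

end Form

theorem wedgeForm_antisymm [Fintype ι] {V : ZMod 2 → Submodule 𝕜 L} (hV : IsCompl (V 0) (V 1))
    {b : Module.Basis ι 𝕜 L} {p : ι → ZMod 2} (hb : ∀ i, b i ∈ V (p i)) {a c : ZMod 2} {x y : L}
    (hx : x ∈ V a) (hy : y ∈ V c) :
    wedgeForm b p x y = -(superSign 𝕜 a c • wedgeForm b p y x) := by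
  ext i j
  simp only [Pi.neg_apply, Pi.smul_apply, wedgeForm_apply, smul_eq_mul]
  have e1 : superSign 𝕜 (p i) (p j) * (b.repr x j * b.repr y i) =
      superSign 𝕜 a c * (b.repr x j * b.repr y i) := by
    by_cases hj : p j = a
    · by_cases hi : p i = c
      · rw [hi, hj, superSign_comm]
      · simp [repr_eq_zero_of_mem hV hb hy hi]
    · simp [repr_eq_zero_of_mem hV hb hx hj]
  have e2 : superSign 𝕜 (p i) (p j) * (b.repr y j * b.repr x i) =
      superSign 𝕜 a c * (b.repr y j * b.repr x i) := by
    by_cases hi : p i = a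
    · by_cases hj : p j = c
      · rw [hi, hj]
      · simp [repr_eq_zero_of_mem hV hb hy hj]
    · simp [repr_eq_zero_of_mem hV hb hx hi]
  rw [e1, e2]
  linear_combination (-b.repr x i * b.repr y j) * superSign_mul_self (𝕜 := 𝕜) a c

end Linear

/-! ### Homogeneous components, commutators and the center of a pair. -/

namespace LieSuperalgebra

section Extension

variable {𝕜 : Type*} [Field 𝕜] {L : Type*} [AddCommGroup L] [Module 𝕜 L] [LieSuperalgebra 𝕜 L]

theorem exists_eq_add (x : L) :
    ∃ x₀ ∈ (part 0 : Submodule 𝕜 L), ∃ x₁ ∈ (part 1 : Submodule 𝕜 L), x = x₀ + x₁ := by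
  have hx : x ∈ (part 0 : Submodule 𝕜 L) ⊔ part 1 := by
    rw [isCompl_part.sup_eq_top]; trivial
  obtain ⟨u, hu, v, hv, rfl⟩ := Submodule.mem_sup.1 hx
  exact ⟨u, hu, v, hv, rfl⟩

theorem eq_zero_of_add_eq_zero {x₀ x₁ : L} (h₀ : x₀ ∈ (part 0 : Submodule 𝕜 L))
    (h₁ : x₁ ∈ (part 1 : Submodule 𝕜 L)) (h : x₀ + x₁ = 0) : x₀ = 0 ∧ x₁ = 0 := by
  have : x₀ = 0 := Submodule.disjoint_def.1 (isCompl_part (𝕜 := 𝕜) (L := L)).disjoint _ h₀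
    (by rw [eq_neg_of_add_eq_zero_left h]; exact neg_mem h₁)
  exact ⟨this, by simpa [this] using h⟩

theorem br_mem_commutator {A B : Submodule 𝕜 L} {x y : L} (hx : x ∈ A) (hy : y ∈ B) :
    br 𝕜 x y ∈ commutator 𝕜 A B :=
  Submodule.subset_span ⟨x, hx, y, hy, rfl⟩

theorem commutator_mono_left {A A' : Submodule 𝕜 L} (h : A ≤ A') (B : Submodule 𝕜 L) :
    commutator 𝕜 A B ≤ commutator 𝕜 A' B :=
  Submodule.span_mono fun _ ⟨x, hx, y, hy, e⟩ => ⟨x, h hx, y, hy, e⟩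

/-- By bilinearity, `[N,L]` is spanned by brackets of homogeneous elements. When it is
one-dimensional, this supplies a generator that is itself a homogeneous bracket, as the Jacobi
argument needs. -/
theorem exists_homogeneous_br_ne_zero {N : Submodule 𝕜 L} (hN : IsGradedIdeal 𝕜 N)
    (h : commutator 𝕜 N ⊤ ≠ ⊥) : ∃ a c : ZMod 2, ∃ x ∈ N, ∃ y : L, x ∈ (part a : Submodule 𝕜 L) ∧
      y ∈ (part c : Submodule 𝕜 L) ∧ br 𝕜 x y ≠ 0 := by
  by_contra! hc
  apply h
  rw [commutator, Submodule.span_eq_bot]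
  rintro _ ⟨x, hx, y, -, rfl⟩
  rw [hN.graded] at hx
  obtain ⟨x₀, hx₀, x₁, hx₁, rfl⟩ := Submodule.mem_sup.1 hx
  obtain ⟨y₀, hy₀, y₁, hy₁, rfl⟩ := exists_eq_add (𝕜 := 𝕜) y
  simp [hc 0 0 x₀ hx₀.1 y₀ hx₀.2 hy₀, hc 0 1 x₀ hx₀.1 y₁ hx₀.2 hy₁,
    hc 1 0 x₁ hx₁.1 y₀ hx₁.2 hy₀, hc 1 1 x₁ hx₁.1 y₁ hx₁.2 hy₁]

/-- The center of a pair is graded. -/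
theorem exists_eq_add_of_mem_pairCenter {N : Submodule 𝕜 L} (hN : IsGradedIdeal 𝕜 N) {z : L}
    (hz : z ∈ pairCenter 𝕜 N) : ∃ z₀ ∈ pairCenter 𝕜 N, ∃ z₁ ∈ pairCenter 𝕜 N,
      z₀ ∈ (part 0 : Submodule 𝕜 L) ∧ z₁ ∈ (part 1 : Submodule 𝕜 L) ∧ z = z₀ + z₁ := by
  have hzN := hz.1
  rw [hN.graded] at hzN
  obtain ⟨z₀, h₀, z₁, h₁, rfl⟩ := Submodule.mem_sup.1 hzN
  have e0 : ∀ y ∈ (part 0 : Submodule 𝕜 L), br 𝕜 z₀ y = 0 ∧ br 𝕜 z₁ y = 0 := fun y hy =>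
    eq_zero_of_add_eq_zero (𝕜 := 𝕜) (br_mem (a := 0) (b := 0) h₀.2 hy)
      (br_mem (a := 1) (b := 0) h₁.2 hy) (by simpa using hz.2 y)
  have e1 : ∀ y ∈ (part 1 : Submodule 𝕜 L), br 𝕜 z₁ y = 0 ∧ br 𝕜 z₀ y = 0 := fun y hy =>
    eq_zero_of_add_eq_zero (𝕜 := 𝕜) (br_mem (a := 1) (b := 1) h₁.2 hy)
      (br_mem (a := 0) (b := 1) h₀.2 hy) (by rw [add_comm]; simpa using hz.2 y)
  refine ⟨z₀, ⟨h₀.1, fun y => ?_⟩, z₁, ⟨h₁.1, fun y => ?_⟩, h₀.2, h₁.2, rfl⟩ <;>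
    obtain ⟨y₀, hy₀, y₁, hy₁, rfl⟩ := exists_eq_add (𝕜 := 𝕜) y
  · rw [map_add, (e0 _ hy₀).1, (e1 _ hy₁).2, add_zero]
  · rw [map_add, (e0 _ hy₀).2, (e1 _ hy₁).1, add_zero]

/-- In a nilpotent Lie superalgebra a commutator `[N, L]` of dimension one is central. -/
theorem commutator_le_pairCenter (hL : IsNilpotent 𝕜 L) {N : Submodule 𝕜 L}
    (hN : IsGradedIdeal 𝕜 N) (h : Module.finrank 𝕜 (commutator 𝕜 N ⊤) = 1) :
    commutator 𝕜 N ⊤ ≤ pairCenter 𝕜 N := by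
  have hle : commutator 𝕜 N ⊤ ≤ N := Submodule.span_le.2 (by
    rintro _ ⟨x, hx, y, -, rfl⟩; exact hN.br_mem x hx y)
  have hfd : FiniteDimensional 𝕜 (commutator 𝕜 N ⊤) := FiniteDimensional.of_finrank_pos (by omega)
  have hne : commutator 𝕜 N ⊤ ≠ ⊥ := by
    intro h0; rw [h0, finrank_bot] at h; omega
  by_cases h0 : commutator 𝕜 (commutator 𝕜 N ⊤) ⊤ = ⊥
  · intro w hw
    refine ⟨hle hw, fun y => ?_⟩
    have : br 𝕜 w y ∈ commutator 𝕜 (commutator 𝕜 N ⊤) ⊤ := br_mem_commutator hw trivial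
    rwa [h0, Submodule.mem_bot] at this
  · exfalso
    have hfd' := Submodule.finiteDimensional_of_le (commutator_mono_left hle (⊤ : Submodule 𝕜 L))
    have hpos := Submodule.one_le_finrank_iff.2 h0
    -- A nonzero subspace of a line is the whole line, so bracketing with `L` preserves `[N,L]`,
    -- which then lies in every term of the lower central series.
    have heq : commutator 𝕜 (commutator 𝕜 N ⊤) ⊤ = commutator 𝕜 N ⊤ :=
      Submodule.eq_of_le_of_finrank_le (commutator_mono_left hle _) (by omega)
    obtain ⟨k, hk⟩ := hL
    have : ∀ i, commutator 𝕜 N ⊤ ≤ lowerCentral 𝕜 L i := by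
      intro i
      induction i with
      | zero => exact le_top
      | succ i ih => rw [← heq]; exact commutator_mono_left ih _
    exact hne (le_bot_iff.1 (hk ▸ this k))

/-! ### The form on `L` induced by a surjection onto it. -/

variable {F : Type*} [AddCommGroup F] [Module 𝕜 F] [LieSuperalgebra 𝕜 F] {π : Hom 𝕜 F L}

/-- Split any preimage into components: the one of the wrong degree maps to zero and can be dropped.
Graded identities of `F` can thus be transported to forms on `L`. -/
theorem exists_homogeneous_lift (hπ : Function.Surjective π.toLinearMap) {a : ZMod 2} {x : L}
    (hx : x ∈ (part a : Submodule 𝕜 L)) :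
    ∃ u ∈ (part a : Submodule 𝕜 F), π.toLinearMap u = x := by
  obtain ⟨u, rfl⟩ := hπ x
  obtain ⟨u₀, h₀, u₁, h₁, rfl⟩ := exists_eq_add (𝕜 := 𝕜) u
  have m₀ : π.toLinearMap u₀ ∈ (part 0 : Submodule 𝕜 L) := π.map_part 0 u₀ h₀
  have m₁ : π.toLinearMap u₁ ∈ (part 1 : Submodule 𝕜 L) := π.map_part 1 u₁ h₁
  rw [map_add] at hx ⊢
  rcases FreeLieSuper.zmod_two_cases a with rfl | rfl
  · have := eq_zero_of_add_eq_zero (sub_mem m₀ hx) m₁ (by abel)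
    exact ⟨u₀, h₀, by rw [this.2, add_zero]⟩
  · have := eq_zero_of_add_eq_zero m₀ (sub_mem m₁ hx) (by abel)
    exact ⟨u₁, h₁, by rw [this.1, zero_add]⟩

theorem Hom.map_br' (u v : F) :
    π.toLinearMap (br 𝕜 u v) = br 𝕜 (π.toLinearMap u) (π.toLinearMap v) :=
  π.map_br u v

/-- The commutator has the kernel on the left, and antisymmetry holds only for homogeneous elements;
the kernel of an even map is graded, so both arguments can be split. -/
theorem br_ker_mem (f : F) {r : F} (hr : π.toLinearMap r = 0) :
    br 𝕜 f r ∈ commutator 𝕜 (LinearMap.ker π.toLinearMap) ⊤ := by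
  obtain ⟨r₀, h₀, r₁, h₁, rfl⟩ := exists_eq_add (𝕜 := 𝕜) r
  obtain ⟨f₀, g₀, f₁, g₁, rfl⟩ := exists_eq_add (𝕜 := 𝕜) f
  have m₀ : π.toLinearMap r₀ ∈ (part 0 : Submodule 𝕜 L) := π.map_part 0 r₀ h₀
  have m₁ : π.toLinearMap r₁ ∈ (part 1 : Submodule 𝕜 L) := π.map_part 1 r₁ h₁
  rw [map_add] at hr
  obtain ⟨k₀, k₁⟩ := eq_zero_of_add_eq_zero m₀ m₁ hr
  have key : ∀ {a c : ZMod 2} {g s : F}, g ∈ (part a : Submodule 𝕜 F) →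
      s ∈ (part c : Submodule 𝕜 F) → π.toLinearMap s = 0 →
      br 𝕜 g s ∈ commutator 𝕜 (LinearMap.ker π.toLinearMap) ⊤ := by
    intro a c g s hg hs h
    rw [br_antisymm hg hs]
    exact neg_mem (Submodule.smul_mem _ _ (br_mem_commutator h trivial))
  simp only [map_add, LinearMap.add_apply]
  exact add_mem (add_mem (key g₀ h₀ k₀) (key g₁ h₀ k₀)) (add_mem (key g₀ h₁ k₁) (key g₁ h₁ k₁))

variable (π) in
/-- The bracket of `F / [ker π, F]`, as a form on `L`. -/
theorem exists_form (hπ : Function.Surjective π.toLinearMap) :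
    ∃ β : L →ₗ[𝕜] L →ₗ[𝕜] F ⧸ commutator 𝕜 (LinearMap.ker π.toLinearMap) ⊤,
      ∀ u v, β (π.toLinearMap u) (π.toLinearMap v) = Submodule.mkQ _ (br 𝕜 u v) := by
  -- A linear section suffices: changing a lift by an element of the kernel changes the bracket only
  -- within `[ker π, F]`.
  obtain ⟨σ, hσ⟩ := π.toLinearMap.exists_rightInverse_of_surjective (LinearMap.range_eq_top.2 hπ)
  have hs : ∀ x, π.toLinearMap (σ x) = x := fun x => LinearMap.congr_fun hσ x
  refine ⟨((br 𝕜).compl₁₂ σ σ).compr₂ (Submodule.mkQ _), fun u v => ?_⟩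
  refine (Submodule.Quotient.eq _).2 ?_
  have e : br 𝕜 (σ (π.toLinearMap u)) (σ (π.toLinearMap v)) - br 𝕜 u v =
      br 𝕜 (σ (π.toLinearMap u) - u) (σ (π.toLinearMap v)) +
        br 𝕜 u (σ (π.toLinearMap v) - v) := by
    simp
  refine e ▸ add_mem (br_mem_commutator ?_ trivial) (br_ker_mem _ ?_)
  · simp [hs]
  · simp [hs]

section Form

variable {β : L →ₗ[𝕜] L →ₗ[𝕜] F ⧸ commutator 𝕜 (LinearMap.ker π.toLinearMap) ⊤}

theorem form_antisymm (hπ : Function.Surjective π.toLinearMap)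
    (hβ : ∀ u v, β (π.toLinearMap u) (π.toLinearMap v) = Submodule.mkQ _ (br 𝕜 u v))
    {a c : ZMod 2} {x y : L} (hx : x ∈ (part a : Submodule 𝕜 L))
    (hy : y ∈ (part c : Submodule 𝕜 L)) : β x y = -(superSign 𝕜 a c • β y x) := by
  obtain ⟨u, hu, rfl⟩ := exists_homogeneous_lift hπ hx
  obtain ⟨v, hv, rfl⟩ := exists_homogeneous_lift hπ hy
  rw [hβ, hβ, br_antisymm hu hv, map_neg, map_smul]

/-- The Jacobi identity makes the form vanish on central elements and brackets. -/
theorem form_central_br (hπ : Function.Surjective π.toLinearMap)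
    (hβ : ∀ u v, β (π.toLinearMap u) (π.toLinearMap v) = Submodule.mkQ _ (br 𝕜 u v))
    {a c d : ZMod 2} {x y z : L} (hz : z ∈ (part a : Submodule 𝕜 L))
    (hx : x ∈ (part c : Submodule 𝕜 L)) (hy : y ∈ (part d : Submodule 𝕜 L))
    (h : ∀ y, br 𝕜 z y = 0) : β z (br 𝕜 x y) = 0 := by
  obtain ⟨u, hu, rfl⟩ := exists_homogeneous_lift hπ hz
  obtain ⟨v, hv, rfl⟩ := exists_homogeneous_lift hπ hx
  obtain ⟨w, hw, rfl⟩ := exists_homogeneous_lift hπ hy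
  rw [← Hom.map_br', hβ, Submodule.mkQ_apply, Submodule.Quotient.mk_eq_zero]
  -- The other two Jacobi terms have an inner bracket containing the lift `u` of the central
  -- element. That inner bracket lies in `ker π`, so both terms die modulo `[ker π, F]`.
  have hj := br_jacobi hu hv hw
  have h1 : br 𝕜 v (br 𝕜 w u) ∈ commutator 𝕜 (LinearMap.ker π.toLinearMap) ⊤ :=
    br_ker_mem _ (by rw [br_antisymm hw hu, map_neg, map_smul, Hom.map_br', h]; simp)
  have h2 : br 𝕜 w (br 𝕜 u v) ∈ commutator 𝕜 (LinearMap.ker π.toLinearMap) ⊤ :=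
    br_ker_mem _ (by rw [Hom.map_br', h])
  rw [← Submodule.smul_mem_iff _ (superSign_ne_zero (𝕜 := 𝕜) a d), 
    eq_neg_of_add_eq_zero_left ((add_assoc _ _ _).symm.trans hj)]
  exact neg_mem (add_mem (Submodule.smul_mem _ _ h1) (Submodule.smul_mem _ _ h2))

end Form

end Extension

/-! ### The dimension of the Schur multiplier of a pair. -/

namespace FreePresentation

variable {𝕜 : Type*} {L : Type*} [Field 𝕜] [AddCommGroup L] [Module 𝕜 L] [LieSuperalgebra 𝕜 L]
  (P : FreePresentation 𝕜 L) (N : Submodule 𝕜 L)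

/-- `[S, F] / [R, F]`, as a subspace of `F / [R, F]`. -/
noncomputable def commutatorQuotient : Submodule 𝕜 (P.F ⧸ commutator 𝕜 P.R ⊤) :=
  (commutator 𝕜 (P.S N) ⊤).map (Submodule.mkQ _)

variable {P N}

theorem map_commutator_S : (commutator 𝕜 (P.S N) ⊤).map P.π.toLinearMap = commutator 𝕜 N ⊤ := by
  rw [commutator, Submodule.map_span, commutator]
  congr 1
  ext z
  constructor
  · rintro ⟨_, ⟨u, hu, v, -, rfl⟩, rfl⟩
    exact ⟨_, hu, _, trivial, (Hom.map_br' u v).symm⟩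
  · rintro ⟨x, hx, y, -, rfl⟩
    obtain ⟨u, rfl⟩ := P.surjective x
    obtain ⟨v, rfl⟩ := P.surjective y
    exact ⟨_, ⟨u, hx, v, trivial, rfl⟩, Hom.map_br' u v⟩

theorem commutatorQuotient_eq_span {β : L →ₗ[𝕜] L →ₗ[𝕜] P.F ⧸ commutator 𝕜 P.R ⊤}
    (hβ : ∀ u v, β (P.π.toLinearMap u) (P.π.toLinearMap v) = Submodule.mkQ _ (br 𝕜 u v)) :
    P.commutatorQuotient N = Submodule.span 𝕜 {z | ∃ x ∈ N, ∃ y, β x y = z} := by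
  refine (Submodule.map_span _ _).trans ?_
  congr 1
  ext z
  constructor
  · rintro ⟨_, ⟨u, hu, v, -, rfl⟩, rfl⟩
    exact ⟨_, hu, _, hβ u v⟩
  · rintro ⟨x, hx, y, rfl⟩
    obtain ⟨u, rfl⟩ := P.surjective x
    obtain ⟨v, rfl⟩ := P.surjective y
    exact ⟨_, ⟨u, hx, v, trivial, rfl⟩, (hβ u v).symm⟩

/-- Rank-nullity for the projection of `[S,F]/[R,F]` onto `[N,L]`: its kernel is the image of `R ∩
[S,F]` modulo `[R,F]`, a copy of the multiplier. -/
theorem finrank_schurMultiplier_add [FiniteDimensional 𝕜 (P.commutatorQuotient N)] :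
    Module.finrank 𝕜 (P.SchurMultiplier N) + Module.finrank 𝕜 (commutator 𝕜 N ⊤) =
      Module.finrank 𝕜 (P.commutatorQuotient N) := by
  have hRF : commutator 𝕜 P.R ⊤ ≤ LinearMap.ker P.π.toLinearMap := by
    refine Submodule.span_le.2 ?_
    rintro _ ⟨x, hx, y, -, rfl⟩
    have hx' : P.π.toLinearMap x = 0 := hx
    change P.π.toLinearMap (br 𝕜 x y) = 0
    rw [Hom.map_br', hx', map_zero, LinearMap.zero_apply]
  let ψ : ↥(P.R ⊓ commutator 𝕜 (P.S N) ⊤) →ₗ[𝕜] P.F ⧸ commutator 𝕜 P.R ⊤ :=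
    (Submodule.mkQ _) ∘ₗ (Submodule.subtype _)
  have hψ : LinearMap.ker ψ =
      (commutator 𝕜 P.R ⊤).submoduleOf (P.R ⊓ commutator 𝕜 (P.S N) ⊤) := by
    rw [LinearMap.ker_comp, Submodule.ker_mkQ]; rfl
  have e1 : Module.finrank 𝕜 (P.SchurMultiplier N) = Module.finrank 𝕜 (LinearMap.range ψ) := by
    refine Eq.trans ?_ ψ.quotKerEquivRange.finrank_eq
    rw [hψ]
  let ρ : P.commutatorQuotient N →ₗ[𝕜] L :=
    ((commutator 𝕜 P.R ⊤).liftQ P.π.toLinearMap hRF).domRestrict _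
  have hρ : LinearMap.range ρ = commutator 𝕜 N ⊤ := by
    rw [← map_commutator_S (P := P), LinearMap.range_domRestrict, commutatorQuotient,
      ← Submodule.map_comp, Submodule.liftQ_mkQ]
  have hk : (LinearMap.ker ρ).map (Submodule.subtype _) = LinearMap.range ψ := by
    ext q
    constructor
    · rintro ⟨⟨_, ⟨e, he, rfl⟩⟩, hq, rfl⟩
      exact ⟨⟨e, hq, he⟩, rfl⟩
    · rintro ⟨⟨e, he, he'⟩, rfl⟩
      exact ⟨⟨_, ⟨e, he', rfl⟩⟩, he, rfl⟩
  rw [e1, ← hk, Submodule.finrank_map_subtype_eq, ← hρ, add_comm]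
  exact ρ.finrank_range_add_finrank_ker

end FreePresentation

end LieSuperalgebra

/-! ### The extension by the super exterior square. -/

namespace LieSuperalgebra

variable {𝕜 : Type*} [Field 𝕜] {L : Type*} [AddCommGroup L] [Module 𝕜 L] [LieSuperalgebra 𝕜 L]

/-- The central extension of the superspace `L`, with trivial bracket, by its super exterior
square, in the coordinates of a homogeneous basis. -/
@[reducible]
noncomputable def wedgeExtension {ι : Type*} [Fintype ι] {b : Module.Basis ι 𝕜 L} {p : ι → ZMod 2}
    (hb : ∀ i, b i ∈ (part (p i) : Submodule 𝕜 L)) : LieSuperalgebra 𝕜 (L × (ι → ι → 𝕜)) where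
  part a := (part a : Submodule 𝕜 L).prod
    { carrier := {f | ∀ i j, p i + p j ≠ a → f i j = 0}
      zero_mem' := fun _ _ _ => rfl
      add_mem' := fun hf hg i j h => by simp [hf i j h, hg i j h]
      smul_mem' := fun c f hf i j h => by simp [hf i j h] }
  isCompl_part := by
    constructor
    · rw [Submodule.disjoint_def]
      rintro ⟨x, f⟩ ⟨hx, hf⟩ ⟨hx', hf'⟩
      refine Prod.ext (Submodule.disjoint_def.1 isCompl_part.disjoint x hx hx') ?_
      ext i j
      by_cases h : p i + p j = 0
      · exact hf' i j (by rw [h]; exact zero_ne_one)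
      · exact hf i j h
    · rw [codisjoint_iff, eq_top_iff]
      rintro ⟨x, f⟩ -
      obtain ⟨x₀, h₀, x₁, h₁, rfl⟩ := exists_eq_add (𝕜 := 𝕜) x
      refine Submodule.mem_sup.2 ⟨(x₀, fun i j => if p i + p j = 0 then f i j else 0),
        ⟨h₀, fun i j h => if_neg h⟩, (x₁, fun i j => if p i + p j = 0 then 0 else f i j),
        ⟨h₁, fun i j h => if_pos ?_⟩, ?_⟩
      · exact (FreeLieSuper.zmod_two_cases _).resolve_right h
      · refine Prod.ext rfl ?_
        ext i j
        by_cases h : p i + p j = 0 <;> simp [h]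
  br := ((wedgeForm b p).compl₁₂ (LinearMap.fst 𝕜 L _) (LinearMap.fst 𝕜 L _)).compr₂
    (LinearMap.inr 𝕜 L _)
  br_mem := by
    rintro a c ⟨x, f⟩ ⟨y, g⟩ ⟨hx, -⟩ ⟨hy, -⟩
    refine ⟨zero_mem _, fun i j h => ?_⟩
    change b.repr x i * b.repr y j - superSign 𝕜 (p i) (p j) * (b.repr x j * b.repr y i) = 0
    have key : ∀ i j, p i + p j ≠ a + c → b.repr x i * b.repr y j = 0 := by
      intro i j h
      by_cases hi : p i = a
      · by_cases hj : p j = c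
        · exact absurd (by rw [hi, hj]) h
        · rw [repr_eq_zero_of_mem isCompl_part hb hy hj, mul_zero]
      · rw [repr_eq_zero_of_mem isCompl_part hb hx hi, zero_mul]
    rw [key i j h, key j i (by rwa [add_comm]), mul_zero, sub_zero]
  br_antisymm := by
    rintro a c ⟨x, f⟩ ⟨y, g⟩ ⟨hx, -⟩ ⟨hy, -⟩
    refine Prod.ext (by simp) ?_
    exact wedgeForm_antisymm isCompl_part hb hx hy
  -- Brackets have zero first component and depend only on first components, so every double bracket
  -- vanishes.
  br_jacobi := by
    intros
    simp

namespace FreePresentation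

variable {P : FreePresentation 𝕜 L} {N : Submodule 𝕜 L}

/-- If `L` is abelian, the super exterior square is a quotient of `[F, F] / [R, F]`. -/
theorem exists_comp_form_eq_wedgeForm (hab : IsAbelian 𝕜 L) {ι : Type*} [Fintype ι]
    {b : Module.Basis ι 𝕜 L} {p : ι → ZMod 2} (hb : ∀ i, b i ∈ (part (p i) : Submodule 𝕜 L))
    {β : L →ₗ[𝕜] L →ₗ[𝕜] P.F ⧸ commutator 𝕜 P.R ⊤}
    (hβ : ∀ u v, β (P.π.toLinearMap u) (P.π.toLinearMap v) = Submodule.mkQ _ (br 𝕜 u v)) :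
    ∃ g : (P.F ⧸ commutator 𝕜 P.R ⊤) →ₗ[𝕜] (ι → ι → 𝕜),
      ∀ x y, g (β x y) = wedgeForm b p x y := by
  let _ := wedgeExtension hb
  have hof : ∀ x, FreeLieSuper.of 𝕜 P.parity x ∈ (part (P.parity x) : Submodule 𝕜 P.F) :=
    fun x => ⟨_, FreeLieSuper.word_mem 𝕜 P.parity (.of x), rfl⟩
  have hπof := fun x => P.π.map_part _ _ (hof x)
  obtain ⟨φ, hφ, -⟩ := FreeLieSuper.existsUnique_lift (𝕜 := 𝕜) (p := P.parity)
    (K := L × (ι → ι → 𝕜)) (fun x => (P.π.toLinearMap (FreeLieSuper.of 𝕜 P.parity x), 0))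
    (fun x => show _ ∧ _ from ⟨hπof x, zero_mem _⟩)
  -- The first component of `φ` is a homomorphism because brackets vanish in `L` and in the first
  -- factor; it agrees with `π` on generators, so uniqueness in the universal property applies.
  have hfst : LinearMap.fst 𝕜 L (ι → ι → 𝕜) ∘ₗ φ.toLinearMap = P.π.toLinearMap := by
    let φ₁ : Hom 𝕜 P.F L :=
      { LinearMap.fst 𝕜 L (ι → ι → 𝕜) ∘ₗ φ.toLinearMap with
        map_part := fun a x hx => (φ.map_part a x hx).1
        map_br := fun x y => by
          refine (congrArg Prod.fst (φ.map_br x y)).trans ?_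
          rw [hab]; rfl }
    exact congrArg Hom.toLinearMap ((FreeLieSuper.existsUnique_lift (𝕜 := 𝕜) (p := P.parity)
      (fun x => P.π.toLinearMap (FreeLieSuper.of 𝕜 P.parity x)) hπof).unique (y₁ := φ₁)
        (fun x => congrArg Prod.fst (hφ x)) (fun x => rfl))
  have hf : ∀ u, (φ.toLinearMap u).1 = P.π.toLinearMap u := fun u => LinearMap.congr_fun hfst u
  have hsnd : ∀ u v, (φ.toLinearMap (br 𝕜 u v)).2 =
      wedgeForm b p (P.π.toLinearMap u) (P.π.toLinearMap v) := by
    intro u v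
    rw [← hf, ← hf]
    exact congrArg Prod.snd (φ.map_br u v)
  have hker : commutator 𝕜 P.R ⊤ ≤
      LinearMap.ker (LinearMap.snd 𝕜 L (ι → ι → 𝕜) ∘ₗ φ.toLinearMap) := by
    refine Submodule.span_le.2 ?_
    rintro _ ⟨r, hr, v, -, rfl⟩
    have hr' : P.π.toLinearMap r = 0 := hr
    refine (hsnd r v).trans ?_
    rw [hr', map_zero, LinearMap.zero_apply]
  refine ⟨(commutator 𝕜 P.R ⊤).liftQ _ hker, fun x y => ?_⟩
  obtain ⟨u, rfl⟩ := P.surjective x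
  obtain ⟨v, rfl⟩ := P.surjective y
  rw [hβ]
  exact hsnd u v

end FreePresentation

end LieSuperalgebra

/-! ### The main theorem. -/

open LieSuperalgebra in
theorem theorem3p5 {𝕜 : Type*} [Field 𝕜] [IsAlgClosed 𝕜]
    (h2 : ringChar 𝕜 ≠ 2) (h3 : ringChar 𝕜 ≠ 3)
    {L : Type*} [AddCommGroup L] [Module 𝕜 L] [LieSuperalgebra 𝕜 L] [FiniteDimensional 𝕜 L]
    (hL : IsNilpotent 𝕜 L) (N : Submodule 𝕜 L) (hN : IsGradedIdeal 𝕜 N) (m n : ℕ)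
    (hm : Module.finrank 𝕜 ↥(N ⊓ part 0) = m) (hn : Module.finrank 𝕜 ↥(N ⊓ part 1) = n)
    (P : FreePresentation 𝕜 L)
    (hM : (Module.finrank 𝕜 (P.SchurMultiplier N) : ℚ) =
      1 / 2 * (((m : ℚ) + n) ^ 2 + ((n : ℚ) - m))
        + (Module.finrank 𝕜 N : ℚ) * (Module.finrank 𝕜 (L ⧸ N) : ℚ) - 1) :
    ¬ IsAbelian 𝕜 L ∧
      (commutator 𝕜 N ⊤ = ⊥ ∨
        (Module.finrank 𝕜 (commutator 𝕜 N ⊤) = 1 ∧ commutator 𝕜 N ⊤ = pairCenter 𝕜 N)) := by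
  classical
  have two : (2 : 𝕜) ≠ 0 := Ring.two_ne_zero h2
  obtain ⟨s, b, p, J, hb, hJ, hcard⟩ := exists_graded_basis isCompl_part hN.graded
  have : Finite s := Module.Finite.finite_basis b
  have := Fintype.ofFinite s
  -- An arbitrary order, used only to choose one of each pair `(i, j)`, `(j, i)`.
  let _ : LinearOrder s := linearOrderOfSTO WellOrderingRel
  have hNJ : Module.finrank 𝕜 N = J.ncard := by
    have hli : LinearIndependent 𝕜 fun i : J => b i := b.linearIndependent.comp _
      Subtype.val_injective
    have := finrank_span_eq_card hli
    rw [← Set.image_eq_range, ← hJ] at this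
    rw [this, Set.ncard_eq_toFinset_card', Set.toFinset_card]
  have hLN : Module.finrank 𝕜 (L ⧸ N) = Jᶜ.ncard := by
    have e1 := N.finrank_quotient_add_finrank
    rw [Module.finrank_eq_card_basis b, hNJ, ← Nat.card_eq_fintype_card,
      ← Set.ncard_add_ncard_compl J] at e1
    omega
  have hJmn : J.ncard = m + n := by
    rw [← hm, ← hn, ← hcard, ← hcard, ← Set.ncard_union_eq]
    · congr 1
      ext i
      have := FreeLieSuper.zmod_two_cases (p i)
      simp only [Set.mem_union, Set.mem_ofPred_eq]
      tauto
    · rw [Set.disjoint_left]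
      rintro i ⟨-, h0⟩ ⟨-, h1⟩
      exact zero_ne_one (h0.symm.trans h1)
  have hM' : Module.finrank 𝕜 (P.SchurMultiplier N) + 1 = (wedgeIndex p J).card := by
    have hT := two_mul_card_wedgeIndex p J
    rw [hcard 1, hn, ← hLN, ← hNJ] at hT
    have hT' : (2 * (wedgeIndex p J).card + Module.finrank 𝕜 N : ℚ) =
      (Module.finrank 𝕜 N : ℚ) ^ 2 + 2 * n +
        2 * (Module.finrank 𝕜 N * Module.finrank 𝕜 (L ⧸ N)) := by exact_mod_cast hT
    have e : (Module.finrank 𝕜 N : ℚ) = m + n := by rw [hNJ, hJmn]; push_cast; rfl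
    have : (Module.finrank 𝕜 (P.SchurMultiplier N) + 1 : ℚ) = (wedgeIndex p J).card := by
      rw [hM]
      rw [e] at hT' ⊢
      linarith
    exact_mod_cast this
  obtain ⟨β, hβ⟩ : ∃ β : L →ₗ[𝕜] L →ₗ[𝕜] P.F ⧸ commutator 𝕜 P.R ⊤,
      ∀ u v, β (P.π.toLinearMap u) (P.π.toLinearMap v) = Submodule.mkQ _ (br 𝕜 u v) :=
    exists_form P.π P.surjective
  let v : wedgeIndex p J → P.F ⧸ commutator 𝕜 P.R ⊤ := fun t => β (b t.1.1) (b t.1.2)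
  have hbN : ∀ i ∈ J, b i ∈ N := fun i hi => by
    rw [hJ]; exact Submodule.subset_span ⟨i, hi, rfl⟩
  have hQ : P.commutatorQuotient N = Submodule.span 𝕜 (Set.range v) := by
    rw [FreePresentation.commutatorQuotient_eq_span hβ]
    apply le_antisymm <;> rw [Submodule.span_le]
    · rintro _ ⟨x, hx, y, rfl⟩
      have hv : ∀ t ∈ wedgeIndex p J, β (b t.1) (b t.2) ∈ Submodule.span 𝕜 (Set.range v) :=
        fun t ht => Submodule.subset_span ⟨⟨t, ht⟩, rfl⟩
      exact form_mem_of_wedgeIndex two (form_antisymm P.surjective hβ) hb hJ _ hv hx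
    · rintro _ ⟨t, rfl⟩
      refine Submodule.subset_span ?_
      exact ⟨b t.1.1, hbN _ (mem_wedgeIndex.1 t.2).1, b t.1.2, rfl⟩
  have hfd : FiniteDimensional 𝕜 (P.commutatorQuotient N) := by
    rw [hQ]; exact FiniteDimensional.span_of_finite 𝕜 (Set.finite_range v)
  have hdim := FreePresentation.finrank_schurMultiplier_add (P := P) (N := N)
  have hle : Module.finrank 𝕜 (P.commutatorQuotient N) ≤ (wedgeIndex p J).card := by
    rw [hQ]
    exact (finrank_range_le_card v).trans (by simp)
  have hw := linearIndependent_wedgeForm two b p J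
  refine ⟨fun hab => ?_, or_iff_not_imp_left.2 fun hne => ?_⟩
  -- In the abelian case a linear map carries `v` to an independent family, so the multiplier would
  -- have dimension `w`, one more than assumed.
  · obtain ⟨g, hg⟩ := FreePresentation.exists_comp_form_eq_wedgeForm hab hb hβ
    have hv : LinearIndependent 𝕜 v := by
      refine LinearIndependent.of_comp g ?_
      convert hw using 2 with t
      exact hg _ _
    have h0 : commutator 𝕜 N ⊤ = ⊥ := by
      refine Submodule.span_eq_bot.2 ?_
      rintro _ ⟨x, -, y, -, rfl⟩
      exact hab x y
    rw [hQ, finrank_span_eq_card hv, h0, finrank_bot, Fintype.card_coe] at hdim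
    omega
  · have hpos := Submodule.one_le_finrank_iff.2 hne
    -- `dim M + dim [N,L] = dim Q ≤ w = dim M + 1`, with `[N,L]` nonzero. Equality holds throughout,
    -- so the spanning family `v` is a basis of `Q`.
    have h1 : Module.finrank 𝕜 (commutator 𝕜 N ⊤) = 1 := by omega
    refine ⟨h1, le_antisymm (commutator_le_pairCenter hL hN h1) ?_⟩
    have hv : LinearIndependent 𝕜 v := by
      rw [linearIndependent_iff_card_eq_finrank_span, Set.finrank, ← hQ, Fintype.card_coe]
      omega
    obtain ⟨g, hg⟩ := LinearMap.exists_extend ((Module.Basis.span hv).constr 𝕜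
      fun t => wedgeForm b p (b t.1.1) (b t.1.2))
    have hgv : ∀ t, g (v t) = wedgeForm b p (b t.1.1) (b t.1.2) := by
      intro t
      have h := LinearMap.congr_fun hg (Module.Basis.span hv t)
      rw [Module.Basis.constr_basis] at h
      rw [← h, LinearMap.comp_apply, Submodule.subtype_apply, Module.Basis.span_apply]
    have hgβ : ∀ x ∈ N, ∀ y, g (β x y) = wedgeForm b p x y := by
      intro x hx y
      -- The difference of the two forms is super-antisymmetric and vanishes on the index pairs; the
      -- target subspace `⊥` turns membership into vanishing on `N × L`.
      have h := form_mem_of_wedgeIndex (V := part) (β := β.compr₂ g - wedgeForm b p) two ?_ hb hJ ⊥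
        ?_ hx (y := y)
      · simpa [sub_eq_zero] using h
      · intro a c x y hx hy
        have h1 : β x y = -(superSign 𝕜 a c • β y x) := form_antisymm P.surjective hβ hx hy
        have h2 := wedgeForm_antisymm isCompl_part hb hx hy
        simp only [LinearMap.sub_apply, LinearMap.compr₂_apply, smul_sub]
        rw [h1, h2, map_neg, map_smul]
        abel
      · intro t ht
        rw [Submodule.mem_bot]
        exact sub_eq_zero.2 (hgv ⟨t, ht⟩)
    obtain ⟨a, c, x, hx, y, hxa, hyc, hxy⟩ := exists_homogeneous_br_ne_zero hN hne
    -- Homogeneous central elements suffice, since the center of the pair is graded; each is a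
    -- multiple of `[x, y]` because `z ∧ [x, y] = 0`.
    have hom : ∀ {d : ZMod 2} {z : L}, z ∈ pairCenter 𝕜 N → z ∈ (part d : Submodule 𝕜 L) →
        z ∈ commutator 𝕜 N ⊤ := by
      intro d z hz hzd
      have h0 : wedgeForm b p z (br 𝕜 x y) = 0 := by
        have h1 : β z (br 𝕜 x y) = 0 := form_central_br P.surjective hβ hzd hxa hyc hz.2
        rw [← hgβ z hz.1, h1, map_zero]
      refine Submodule.span_le.2 ?_ (mem_span_singleton_of_wedgeForm_eq_zero isCompl_part hb hzd
        (br_mem hxa hyc) hxy h0)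
      rw [Set.singleton_subset_iff]
      exact br_mem_commutator hx trivial
    intro z hz
    obtain ⟨z₀, hz₀, z₁, hz₁, h₀, h₁, rfl⟩ := exists_eq_add_of_mem_pairCenter hN hz
    exact add_mem (hom hz₀ h₀) (hom hz₁ h₁)
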